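/- Let $G$ be a group. Let $\mathcal{L}_G$ denote the lattice of all (not necessarily Hausdorff) group topologies on $G$, ordered by inclusion: $\tau\le\sigma$ if and only if $\sigma$ is finer than $\tau$. In a lattice, write $b\prec a$ if $b<a$ and there is no $c$ with $b<c<a$, and write $b\preceq a$ if $b\prec a$ or $b=a$. A lattice is called semi-modular if it satisfies the upper covering condition: whenever $b\prec a$, one has $b\vee c\preceq a\vee c$ for every element $c$ of the lattice. Let $N$ be a central subgroup of $G$, i.e. a subgroup contained in the centre of $G$. Then $\mathcal{L}_G$ is semi-modular if and only if $\mathcal{L}_{G/N}$ is semi-modular. -/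

import Mathlib

/-!
A group topology is determined by its filter of neighbourhoods of `1`. When the filters of `s` and
`t` commute, their product is that of `s ⊔ t`, and Dedekind's modular law `z ⊓ (s ⊔ t) = z ⊓ s ⊔ t`
holds for all `t ≤ z`. Let `m` be the group topology in which the central subgroup `N` is the least
neighbourhood of `1`; the group topologies on `G ⧸ N` correspond to those above `m`. The filter of
`m` commutes with all others, and the filters of `s` and `t` commute whenever `t ≤ s ⊔ m`, because
then every small element for `t` is a small element for `s` up to a central factor.

Given a covering `a ⋖ a ⊔ b`, either `b ≤ a ⊔ m`, and the modular law turns it into `a ⊓ b ⋖ b`, or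
joining with `m` preserves the covering, semi-modularity applies above `m`, and the modular laws for
`m` bring the resulting covering back down to `a ⊓ b ⋖ b`.

All of this is in the order of `GroupTopology`, where coarser topologies are larger, so that
semi-modularity becomes lower modularity.
-/

/-- The lattice of all (not necessarily Hausdorff) group topologies on `G`, ordered by inclusion of
the families of open sets: `τ ≤ σ` iff `σ` is finer than `τ`.  Mathlib's order on `GroupTopology G`
is the reverse one, hence the order dual. -/
abbrev GroupTopologyLattice (G : Type*) [Group G] : Type _ := (GroupTopology G)ᵒᵈ

/-- The order is inclusion of the families of open sets. -/
theorem GroupTopologyLattice.le_iff {G : Type*} [Group G] (τ σ : GroupTopologyLattice G) :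
    τ ≤ σ ↔ ∀ U : Set G, (OrderDual.ofDual τ).IsOpen U →
      (OrderDual.ofDual σ).IsOpen U :=
  Iff.rfl

/-- A lattice is (upper) semi-modular if it satisfies the upper covering condition: whenever `a`
covers `b`, for every `c` the element `a ⊔ c` covers or equals `b ⊔ c`. -/
def IsSemimodularLattice (L : Type*) [Lattice L] : Prop :=
  ∀ a b : L, b ⋖ a → ∀ c : L, b ⊔ c ⋖ a ⊔ c ∨ b ⊔ c = a ⊔ c

/-- A central subgroup is normal (needed to speak of the quotient group). -/
theorem Subgroup.normal_of_central {G : Type*} [Group G] {N : Subgroup G}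
    (hN : N ≤ Subgroup.center G) : N.Normal where
  conj_mem n hn g := by
    rw [Subgroup.mem_center_iff.mp (hN hn) g, mul_inv_cancel_right]
    exact hn

section Lattice

variable {L L' : Type*} [Lattice L] [Lattice L']

theorem isSemimodularLattice_iff_isUpperModularLattice :
    IsSemimodularLattice L ↔ IsUpperModularLattice L := by
  refine ⟨fun h => ⟨fun {a b} hab => ?_⟩, fun _ a b hba c => ?_⟩
  · have hcov := h a (a ⊓ b) hab b
    rw [sup_eq_right.2 (inf_le_right : a ⊓ b ≤ b)] at hcov
    exact hcov.resolve_right (right_lt_sup.2 (inf_lt_left.1 hab.lt)).ne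
  · rcases hba.eq_or_eq (le_inf hba.le (le_sup_left (b := c))) inf_le_left with hinf | hinf
    · have hcov := covBy_sup_of_inf_covBy_left (hinf.symm ▸ hba : a ⊓ (b ⊔ c) ⋖ a)
      rw [← sup_assoc, sup_eq_left.2 hba.le] at hcov
      exact .inl hcov
    · exact .inr ((sup_le_sup_right hba.le c).antisymm (sup_le (inf_eq_left.1 hinf) le_sup_right))

theorem isSemimodularLattice_orderDual_iff :
    IsSemimodularLattice Lᵒᵈ ↔ IsLowerModularLattice L :=
  isSemimodularLattice_iff_isUpperModularLattice.trans
    ⟨fun _ => inferInstanceAs (IsLowerModularLattice Lᵒᵈᵒᵈ), fun _ => inferInstance⟩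

theorem isLowerModularLattice_of_latticeHom [IsLowerModularLattice L'] (f : LatticeHom L L')
    (hf : Function.Injective f) (hconn : (Set.range f).OrdConnected) :
    IsLowerModularLattice L where
  inf_covBy_of_covBy_sup {a b} hab := by
    let e : L ↪o L' := .ofMapLEIff f fun x y => by
      rw [← sup_eq_right, ← map_sup, hf.eq_iff, sup_eq_right]
    have hcov (x y : L) : f x ⋖ f y ↔ x ⋖ y := hconn.apply_covBy_apply_iff e
    rw [← hcov, map_sup] at hab
    rw [← hcov, map_inf]
    exact inf_covBy_of_covBy_sup_left hab

theorem isLowerModularLattice_congr (e : L ≃o L') :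
    IsLowerModularLattice L ↔ IsLowerModularLattice L' :=
  ⟨fun _ => isLowerModularLattice_of_latticeHom (e.symm : LatticeHom L' L) e.symm.injective
      (Set.ordConnected_range e.symm),
    fun _ => isLowerModularLattice_of_latticeHom (e : LatticeHom L L') e.injective
      (Set.ordConnected_range e)⟩

theorem isLowerModularLattice_Ici [IsLowerModularLattice L] (m : L) :
    IsLowerModularLattice (Set.Ici m) :=
  isLowerModularLattice_of_latticeHom ⟨⟨Subtype.val, fun _ _ => rfl⟩, fun _ _ => rfl⟩
    Subtype.val_injective (Subtype.range_val.symm ▸ Set.ordConnected_Ici)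

/-- `(a, b)` is a modular pair: the modular law `(x ⊔ a) ⊓ b = x ⊔ a ⊓ b` holds for all `x ≤ b`.
Only the nontrivial inequality is recorded. -/
def IsModularPair (a b : L) : Prop :=
  ∀ ⦃x⦄, x ≤ b → (x ⊔ a) ⊓ b ≤ x ⊔ a ⊓ b

/-- `(a, b)` is a dual modular pair: the modular law `z ⊓ (a ⊔ b) = z ⊓ a ⊔ b` holds for all
`z ≥ b`. Only the nontrivial inequality is recorded. -/
def IsDualModularPair (a b : L) : Prop :=
  ∀ ⦃z⦄, b ≤ z → z ⊓ (a ⊔ b) ≤ z ⊓ a ⊔ b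

variable {a b c m : L}

theorem IsModularPair.inf_covBy_of_covBy_sup (h : IsModularPair a b) (hab : a ⋖ a ⊔ b) :
    a ⊓ b ⋖ b := by
  refine ⟨inf_lt_right.2 (left_lt_sup.1 hab.lt), fun y hy hyb => ?_⟩
  have hya : (y ⊔ a) ⊓ b ≤ y := (h hyb.le).trans (sup_le le_rfl hy.le)
  rcases hab.eq_or_eq le_sup_right (sup_le (hyb.le.trans le_sup_right) le_sup_left) with e | e
  · exact hy.not_ge (le_inf (sup_eq_right.1 e) hyb.le)
  · exact hyb.not_ge ((le_inf (e ▸ le_sup_right) le_rfl).trans hya)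

theorem IsDualModularPair.covBy_sup_of_inf_covBy (h : IsDualModularPair a b) (hab : a ⊓ b ⋖ a) :
    b ⋖ a ⊔ b :=
  have hdual : IsModularPair (OrderDual.toDual a) (OrderDual.toDual b) := h
  (hdual.inf_covBy_of_covBy_sup hab.toDual).ofDual

theorem IsDualModularPair.of_le_of_le_sup (h : IsDualModularPair a b) (hbc : b ≤ c)
    (hca : c ≤ a ⊔ b) : IsDualModularPair a c := fun z hz =>
  calc z ⊓ (a ⊔ c) ≤ z ⊓ (a ⊔ b) := inf_le_inf_left z (sup_le le_sup_left hca)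
    _ ≤ z ⊓ a ⊔ b := h (hbc.trans hz)
    _ ≤ z ⊓ a ⊔ c := sup_le_sup_left hbc _

theorem isModularPair_of_le_of_le_sup (hleft : ∀ x, IsDualModularPair m x)
    (hright : ∀ x, IsDualModularPair x m) (hma : m ≤ a) (ham : a ≤ b ⊔ m) :
    IsModularPair a b := fun x hx => by
  have ha : a ≤ a ⊓ b ⊔ m := (le_inf le_rfl ham).trans (hright b hma)
  have hxa : x ⊔ a ≤ m ⊔ (x ⊔ a ⊓ b) :=
    sup_le (le_sup_left.trans le_sup_right)
      (ha.trans (sup_le (le_sup_right.trans le_sup_right) le_sup_left))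
  calc (x ⊔ a) ⊓ b ≤ b ⊓ (m ⊔ (x ⊔ a ⊓ b)) := le_inf inf_le_right (inf_le_left.trans hxa)
    _ ≤ b ⊓ m ⊔ (x ⊔ a ⊓ b) := hleft _ (sup_le hx inf_le_right)
    _ ≤ x ⊔ a ⊓ b :=
      sup_le (le_sup_of_le_right (le_inf (inf_le_right.trans hma) inf_le_left)) le_rfl

theorem inf_covBy_of_covBy_sup_of_le [IsLowerModularLattice (Set.Ici m)] (ha : m ≤ a) (hb : m ≤ b)
    (hab : a ⋖ a ⊔ b) : a ⊓ b ⋖ b := by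
  have hcov (x y : Set.Ici m) : (x : L) ⋖ y ↔ x ⋖ y :=
    Set.OrdConnected.apply_covBy_apply_iff (OrderEmbedding.subtype (m ≤ ·))
      (Subtype.range_val.symm ▸ Set.ordConnected_Ici)
  let a' : Set.Ici m := ⟨a, ha⟩
  let b' : Set.Ici m := ⟨b, hb⟩
  exact (hcov (a' ⊓ b') b').2 (inf_covBy_of_covBy_sup_left ((hcov a' (a' ⊔ b')).1 hab))

theorem isLowerModularLattice_of_Ici [IsLowerModularLattice (Set.Ici m)]
    (hleft : ∀ x, IsDualModularPair m x) (hle : ∀ x y, y ≤ x ⊔ m → IsDualModularPair x y) :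
    IsLowerModularLattice L where
  inf_covBy_of_covBy_sup {a b} hab := by
    by_cases hb : b ≤ a ⊔ m
    · have hpair : IsModularPair a b := fun x hx => by
        simpa only [inf_comm, sup_comm] using hle a x (hx.trans hb) hx
      exact hpair.inf_covBy_of_covBy_sup hab
    have hright (x : L) : IsDualModularPair x m := hle x m le_sup_right
    have hmeet : (a ⊔ b) ⊓ (a ⊔ m) = a :=
      (hab.eq_or_eq (le_inf le_sup_left le_sup_left) inf_le_left).resolve_right
        fun e => hb (le_sup_right.trans (inf_eq_left.1 e))
    have hup : a ⊔ m ⋖ (a ⊔ m) ⊔ (b ⊔ m) := by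
      have hpair : IsDualModularPair (a ⊔ b) (a ⊔ m) :=
        (hright (a ⊔ b)).of_le_of_le_sup le_sup_right (sup_le_sup_right le_sup_left m)
      have hcov := hpair.covBy_sup_of_inf_covBy (hmeet.symm ▸ hab)
      rwa [← sup_sup_distrib_left, ← sup_assoc, sup_sup_distrib_right] at hcov
    have hdown : (a ⊔ m) ⊓ (b ⊔ m) ⋖ b ⊔ m :=
      inf_covBy_of_covBy_sup_of_le le_sup_right le_sup_right hup
    have hpair : IsModularPair ((a ⊔ m) ⊓ (b ⊔ m)) b :=
      isModularPair_of_le_of_le_sup hleft hright (le_inf le_sup_right le_sup_right) inf_le_right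
    have hjoin : (a ⊔ m) ⊓ (b ⊔ m) ⊔ b = b ⊔ m :=
      le_antisymm (sup_le inf_le_right le_sup_left)
        (sup_le le_sup_right (le_sup_of_le_left (le_inf le_sup_right le_sup_right)))
    have hinf : (a ⊔ m) ⊓ (b ⊔ m) ⊓ b = a ⊓ b := by
      rw [inf_assoc, inf_eq_right.2 (le_sup_left : b ≤ b ⊔ m)]
      refine le_antisymm (le_inf ?_ inf_le_right) (inf_le_inf_right b le_sup_left)
      exact (le_inf (inf_le_right.trans le_sup_right) inf_le_left).trans hmeet.le
    exact hinf ▸ hpair.inf_covBy_of_covBy_sup (hjoin.symm ▸ hdown)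

end Lattice

section GroupTopology

open Filter
open scoped Topology Pointwise

variable {G H : Type*} [Group G] [Group H]

theorem mul_inf_le_inf_mul_inv_mul (f g h : Filter G) : f * g ⊓ h ≤ (f ⊓ h * g⁻¹) * g := by
  intro U hU
  obtain ⟨A, hA, B, hB, hABU⟩ := mem_mul.1 hU
  obtain ⟨F, hF, K, hK, rfl⟩ := mem_inf_iff.1 hA
  obtain ⟨C, hC, D, hD, hCDK⟩ := mem_mul.1 hK
  have hprod : F * (B ∩ D⁻¹) ∈ f * g := mul_mem_mul hF (inter_mem hB (mem_inv.1 hD))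
  filter_upwards [mem_inf_of_left hprod, mem_inf_of_right hC]
  rintro _ ⟨x, hx, y, ⟨hyB, hyD⟩, rfl⟩ hxy
  exact hABU ⟨x, ⟨hx, hCDK ⟨x * y, hxy, y⁻¹, hyD, mul_inv_cancel_right x y⟩⟩, y, hyB, rfl⟩

theorem commute_of_le_principal_center {f : Filter G}
    (hf : f ≤ 𝓟 (Subgroup.center G : Set G)) (g : Filter G) : Commute f g := by
  have hcomm : (fun p : G × G => p.1 * p.2) =ᶠ[f ×ˢ g] fun p => p.2 * p.1 := by
    filter_upwards [tendsto_fst.eventually (hf (mem_principal_self _))] with p hp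
    exact (Subgroup.mem_center_iff.1 hp p.2).symm
  calc f * g = map (fun p : G × G => p.1 * p.2) (f ×ˢ g) := (map_prod_eq_map₂ (· * ·) f g).symm
    _ = map (fun p : G × G => p.2 * p.1) (f ×ˢ g) := map_congr hcomm
    _ = map₂ (fun x y => y * x) f g := map_prod_eq_map₂ (fun x y => y * x) f g
    _ = g * f := (map₂_swap (· * ·) g f).symm

/-- The filter of neighbourhoods of `1` in a group topology, which determines the topology. -/
def nhdsOne (t : GroupTopology G) : Filter G := @nhds G t.toTopologicalSpace 1

theorem pure_one_le_nhdsOne (t : GroupTopology G) : 1 ≤ nhdsOne t :=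
  @pure_le_nhds G t.toTopologicalSpace 1

theorem nhdsOne_mul_self (t : GroupTopology G) : nhdsOne t * nhdsOne t = nhdsOne t := by
  let := t.toTopologicalSpace
  have := t.toIsTopologicalGroup
  exact (nhds_mul (1 : G) 1).symm.trans (congrArg 𝓝 (mul_one 1))

theorem inv_nhdsOne (t : GroupTopology G) : (nhdsOne t)⁻¹ = nhdsOne t := by
  let := t.toTopologicalSpace
  have := t.toIsTopologicalGroup
  exact (nhds_inv G 1).symm.trans (congrArg 𝓝 inv_one)

theorem map_conj_nhdsOne_le (t : GroupTopology G) (g : G) :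
    map (MulAut.conj g) (nhdsOne t) ≤ nhdsOne t := by
  let := t.toTopologicalSpace
  have := t.toIsTopologicalGroup
  exact (IsTopologicalGroup.continuous_conj g).tendsto' 1 1 (by simp)

theorem nhdsOne_le_nhdsOne_iff {s t : GroupTopology G} : nhdsOne s ≤ nhdsOne t ↔ s ≤ t := by
  refine ⟨fun h => ?_, fun h => nhds_mono h⟩
  have hnhds (r : GroupTopology G) (x : G) :
      @nhds G r.toTopologicalSpace x = map (x * ·) (nhdsOne r) := by
    let := r.toTopologicalSpace
    have := r.toIsTopologicalGroup
    exact (map_mul_left_nhds_one x).symm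
  refine GroupTopology.toTopologicalSpace_le.1 ((le_iff_nhds _ _).2 fun x => ?_)
  rw [hnhds, hnhds]
  exact map_mono h

theorem nhdsOne_inf (s t : GroupTopology G) : nhdsOne (s ⊓ t) = nhdsOne s ⊓ nhdsOne t :=
  nhds_inf

theorem exists_nhdsOne_eq {f : Filter G} (hone : 1 ≤ f) (hmul : f * f ≤ f) (hinv : f⁻¹ ≤ f)
    (hconj : ∀ g : G, map (MulAut.conj g) f ≤ f) : ∃ t : GroupTopology G, nhdsOne t = f := by
  let B : GroupFilterBasis G :=
    { f.asBasis with
      one' := fun hU => hone hU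
      mul' := fun hU => by
        obtain ⟨V, hV, W, hW, hVW⟩ := mem_mul.1 (hmul hU)
        exact ⟨V ∩ W, inter_mem hV hW,
          (Set.mul_subset_mul Set.inter_subset_left Set.inter_subset_right).trans hVW⟩
      inv' := fun hU => ⟨_, hinv hU, subset_rfl⟩
      conj' := fun g _ hU => ⟨_, hconj g hU, subset_rfl⟩ }
  exact ⟨⟨B.topology, B.isTopologicalGroup⟩, B.nhds_one_eq.trans f.asBasis_filter⟩

theorem nhdsOne_sup_of_commute {s t : GroupTopology G} (h : Commute (nhdsOne s) (nhdsOne t)) :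
    nhdsOne (s ⊔ t) = nhdsOne s * nhdsOne t := by
  obtain ⟨r, hr⟩ : ∃ r : GroupTopology G, nhdsOne r = nhdsOne s * nhdsOne t := by
    refine exists_nhdsOne_eq ?_ ?_ ?_ fun g => ?_
    · simpa only [one_mul] using mul_le_mul' (pure_one_le_nhdsOne s) (pure_one_le_nhdsOne t)
    · rw [h.symm.mul_mul_mul_comm, nhdsOne_mul_self, nhdsOne_mul_self]
    · rw [mul_inv_rev, inv_nhdsOne, inv_nhdsOne, h.eq]
    · rw [Filter.map_mul]
      exact mul_le_mul' (map_conj_nhdsOne_le s g) (map_conj_nhdsOne_le t g)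
  have hs : s ≤ r := nhdsOne_le_nhdsOne_iff.1 <| by
    simpa only [hr, mul_one] using mul_le_mul' (le_refl (nhdsOne s)) (pure_one_le_nhdsOne t)
  have ht : t ≤ r := nhdsOne_le_nhdsOne_iff.1 <| by
    simpa only [hr, one_mul] using mul_le_mul' (pure_one_le_nhdsOne s) (le_refl (nhdsOne t))
  refine le_antisymm (hr ▸ nhdsOne_le_nhdsOne_iff.2 (sup_le hs ht)) ?_
  calc nhdsOne s * nhdsOne t ≤ nhdsOne (s ⊔ t) * nhdsOne (s ⊔ t) :=
        mul_le_mul' (nhdsOne_le_nhdsOne_iff.2 le_sup_left) (nhdsOne_le_nhdsOne_iff.2 le_sup_right)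
    _ = nhdsOne (s ⊔ t) := nhdsOne_mul_self _

theorem isDualModularPair_of_commute {s t : GroupTopology G}
    (h : Commute (nhdsOne s) (nhdsOne t)) : IsDualModularPair s t := fun z htz => by
  have hzt : nhdsOne z * (nhdsOne t)⁻¹ ≤ nhdsOne z :=
    calc nhdsOne z * (nhdsOne t)⁻¹ = nhdsOne z * nhdsOne t := by rw [inv_nhdsOne]
      _ ≤ nhdsOne z * nhdsOne z := mul_le_mul_right (nhdsOne_le_nhdsOne_iff.2 htz) _
      _ = nhdsOne z := nhdsOne_mul_self z
  rw [← nhdsOne_le_nhdsOne_iff]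
  calc nhdsOne (z ⊓ (s ⊔ t)) = nhdsOne s * nhdsOne t ⊓ nhdsOne z := by
        rw [nhdsOne_inf, nhdsOne_sup_of_commute h, inf_comm]
    _ ≤ (nhdsOne s ⊓ nhdsOne z * (nhdsOne t)⁻¹) * nhdsOne t := mul_inf_le_inf_mul_inv_mul _ _ _
    _ ≤ (nhdsOne s ⊓ nhdsOne z) * nhdsOne t := by gcongr
    _ = nhdsOne (z ⊓ s) * nhdsOne t := by rw [nhdsOne_inf, inf_comm]
    _ ≤ nhdsOne (z ⊓ s ⊔ t) * nhdsOne (z ⊓ s ⊔ t) :=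
        mul_le_mul' (nhdsOne_le_nhdsOne_iff.2 le_sup_left) (nhdsOne_le_nhdsOne_iff.2 le_sup_right)
    _ = nhdsOne (z ⊓ s ⊔ t) := nhdsOne_mul_self _

/-- The group topology on `G` induced by a homomorphism to a group with a group topology. -/
def inducedGroupTopology (f : G →* H) (t : GroupTopology H) : GroupTopology G where
  toTopologicalSpace := t.toTopologicalSpace.induced f
  toIsTopologicalGroup :=
    let := t.toTopologicalSpace
    have := t.toIsTopologicalGroup
    topologicalGroup_induced f

theorem nhdsOne_inducedGroupTopology (f : G →* H) (t : GroupTopology H) :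
    nhdsOne (inducedGroupTopology f t) = comap f (nhdsOne t) := by
  refine (@nhds_induced _ _ t.toTopologicalSpace f 1).trans ?_
  rw [map_one]
  rfl

theorem inducedGroupTopology_le_iff {f : G →* H} (hf : Function.Surjective f)
    {s t : GroupTopology H} : inducedGroupTopology f s ≤ inducedGroupTopology f t ↔ s ≤ t := by
  rw [← nhdsOne_le_nhdsOne_iff, nhdsOne_inducedGroupTopology, nhdsOne_inducedGroupTopology,
    ← nhdsOne_le_nhdsOne_iff]
  exact comap_le_comap_iff (hf.range_eq ▸ univ_mem)

section Quotient

variable (N : Subgroup G) [N.Normal]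

/-- The group topology on `G` in which the normal subgroup `N` is the least neighbourhood of `1`;
it is pulled back from the discrete topology on `G ⧸ N`. -/
def normalGroupTopology : GroupTopology G := inducedGroupTopology (QuotientGroup.mk' N) ⊥

theorem nhdsOne_normalGroupTopology : nhdsOne (normalGroupTopology N) = 𝓟 (N : Set G) := by
  have hbot : nhdsOne (⊥ : GroupTopology (G ⧸ N)) = 𝓟 {1} :=
    (congrFun (@nhds_discrete _ ⊥ (discreteTopology_bot _)) 1).trans (principal_singleton 1).symm
  rw [normalGroupTopology, nhdsOne_inducedGroupTopology, hbot, comap_principal]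
  congr 1
  ext x
  simp

/-- The quotient topology on `G ⧸ N` of a group topology on `G`. -/
def quotientGroupTopology (t : GroupTopology G) : GroupTopology (G ⧸ N) :=
  let := t.toTopologicalSpace
  have := t.toIsTopologicalGroup
  ⟨inferInstance, inferInstance⟩

theorem nhdsOne_quotientGroupTopology (t : GroupTopology G) :
    nhdsOne (quotientGroupTopology N t) = map (QuotientGroup.mk' N) (nhdsOne t) := by
  let := t.toTopologicalSpace
  have := t.toIsTopologicalGroup
  exact QuotientGroup.nhds_eq N 1

theorem comap_map_mk' (f : Filter G) :
    comap (QuotientGroup.mk' N) (map (QuotientGroup.mk' N) f) = f * 𝓟 (N : Set G) := by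
  have hbasis := (f.basis_sets.map (QuotientGroup.mk' N)).comap (QuotientGroup.mk' N)
  ext U
  refine hbasis.mem_iff.trans ⟨?_, fun hU => ?_⟩
  · rintro ⟨V, hV, hVU⟩
    exact ⟨V, hV, N, mem_principal_self _, (QuotientGroup.preimage_image_mk_eq_mul N V) ▸ hVU⟩
  · obtain ⟨V, hV, W, hW, hVWU⟩ := mem_mul.1 hU
    exact ⟨V, hV, (QuotientGroup.preimage_image_mk_eq_mul N V).trans_subset
      ((Set.mul_subset_mul_left (mem_principal.1 hW)).trans hVWU)⟩

theorem inducedGroupTopology_quotientGroupTopology {t : GroupTopology G}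
    (ht : normalGroupTopology N ≤ t) :
    inducedGroupTopology (QuotientGroup.mk' N) (quotientGroupTopology N t) = t := by
  have hN : 𝓟 (N : Set G) ≤ nhdsOne t :=
    (nhdsOne_normalGroupTopology N).symm.trans_le (nhdsOne_le_nhdsOne_iff.2 ht)
  have hnhds : nhdsOne (inducedGroupTopology (QuotientGroup.mk' N) (quotientGroupTopology N t)) =
      comap (QuotientGroup.mk' N) (map (QuotientGroup.mk' N) (nhdsOne t)) := by
    rw [nhdsOne_inducedGroupTopology, nhdsOne_quotientGroupTopology]
  refine le_antisymm (nhdsOne_le_nhdsOne_iff.1 ?_) (nhdsOne_le_nhdsOne_iff.1 ?_)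
  · calc _ = nhdsOne t * 𝓟 (N : Set G) := hnhds.trans (comap_map_mk' N _)
      _ ≤ nhdsOne t * nhdsOne t := mul_le_mul_right hN _
      _ = nhdsOne t := nhdsOne_mul_self t
  · exact hnhds ▸ le_comap_map

/-- The lattice of group topologies on `G ⧸ N` as a principal filter in that on `G`. -/
noncomputable def quotientGroupTopologyOrderIso :
    GroupTopology (G ⧸ N) ≃o Set.Ici (normalGroupTopology N) :=
  have hle {s t : GroupTopology (G ⧸ N)} :=
    inducedGroupTopology_le_iff (QuotientGroup.mk'_surjective N) (s := s) (t := t)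
  RelIso.ofSurjective
    (OrderEmbedding.ofMapLEIff
      (fun s => ⟨inducedGroupTopology (QuotientGroup.mk' N) s, hle.2 bot_le⟩) fun _ _ => hle)
    fun t => ⟨quotientGroupTopology N t,
      Subtype.ext (inducedGroupTopology_quotientGroupTopology N t.2)⟩

end Quotient

section Central

variable {N : Subgroup G} [N.Normal] (hN : N ≤ Subgroup.center G)
include hN

theorem commute_nhdsOne_normalGroupTopology (t : GroupTopology G) :
    Commute (nhdsOne (normalGroupTopology N)) (nhdsOne t) :=
  commute_of_le_principal_center
    ((nhdsOne_normalGroupTopology N).trans_le (principal_mono.2 hN)) _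

theorem commute_nhdsOne_of_le_sup {s t : GroupTopology G} (h : t ≤ s ⊔ normalGroupTopology N) :
    Commute (nhdsOne s) (nhdsOne t) := by
  let k := 𝓟 (N : Set G) ⊓ nhdsOne t * (nhdsOne s)⁻¹
  have hk : Commute k (nhdsOne s) :=
    commute_of_le_principal_center (inf_le_left.trans (principal_mono.2 hN)) _
  have htk : nhdsOne t ≤ k * nhdsOne s :=
    calc nhdsOne t ≤ nhdsOne (normalGroupTopology N ⊔ s) ⊓ nhdsOne t :=
          le_inf (nhdsOne_le_nhdsOne_iff.2 (sup_comm s _ ▸ h)) le_rfl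
      _ = 𝓟 (N : Set G) * nhdsOne s ⊓ nhdsOne t := by
          rw [nhdsOne_sup_of_commute (commute_nhdsOne_normalGroupTopology hN s),
            nhdsOne_normalGroupTopology]
      _ ≤ k * nhdsOne s := mul_inf_le_inf_mul_inv_mul _ _ _
  have hst : nhdsOne s * nhdsOne t ≤ nhdsOne t * nhdsOne s :=
    calc nhdsOne s * nhdsOne t ≤ nhdsOne s * (k * nhdsOne s) := mul_le_mul_right htk _
      _ = k * nhdsOne s := by rw [← mul_assoc, ← hk.eq, mul_assoc, nhdsOne_mul_self]
      _ ≤ nhdsOne t * (nhdsOne s)⁻¹ * nhdsOne s := mul_le_mul_left inf_le_right _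
      _ = nhdsOne t * nhdsOne s := by rw [inv_nhdsOne, mul_assoc, nhdsOne_mul_self]
  refine hst.antisymm ?_
  simpa only [mul_inv_rev, inv_nhdsOne] using Filter.inv_le_inv hst

end Central

end GroupTopology

theorem theorem2 {G : Type*} [Group G] (N : Subgroup G) (hN : N ≤ Subgroup.center G) :
    haveI : N.Normal := Subgroup.normal_of_central hN
    IsSemimodularLattice (GroupTopologyLattice G) ↔
      IsSemimodularLattice (GroupTopologyLattice (G ⧸ N)) := by
  have : N.Normal := Subgroup.normal_of_central hN
  rw [isSemimodularLattice_orderDual_iff, isSemimodularLattice_orderDual_iff,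
    isLowerModularLattice_congr (quotientGroupTopologyOrderIso N)]
  exact ⟨fun _ => isLowerModularLattice_Ici _, fun _ => isLowerModularLattice_of_Ici
    (fun s => isDualModularPair_of_commute (commute_nhdsOne_normalGroupTopology hN s))
    fun s t h => isDualModularPair_of_commute (commute_nhdsOne_of_le_sup hN h)⟩
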